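/- Let $\mathbf X$ be a Polish space with its Borel $\sigma$-algebra, and for probability measures $m_1,m_2$ on $\mathbf X$ let $\|m_1-m_2\|_{TV}=\frac12\sup\{\int f\,dm_1-\int f\,dm_2 : f \text{ measurable},\ |f|\le 1\}$. Let $\mathcal P$ and $\mathcal P_\epsilon$ be Markov transition kernels on $\mathbf X$, and let $\alpha\in(0,1)$ and $\epsilon\in(0,\alpha)$ be such that \[ \|\mathcal P_\epsilon(x,\cdot)-\mathcal P(x,\cdot)\|_{TV}\le\epsilon \quad\text{and}\quad \|\mathcal P_\epsilon(x,\cdot)-\mathcal P(y,\cdot)\|_{TV}\le 1-\alpha\qquad\text{for all } x,y\in\mathbf X . \] Then for every probability measure $\nu$ on $\mathbf X\times\mathbf X$ there is a coupling $(X_n,X_n^\epsilon)_{n\ge0}$ of the two chains started from $\nu$, that is, random variables on one probability space such that $(X_0,X_0^\epsilon)$ has law $\nu$, and $(X_n)$ and $(X_n^\epsilon)$ are Markov chains with transition kernels $\mathcal P$ and $\mathcal P_\epsilon$ respectively (each with respect to the filtration generated by the pair process, hence also with respect to its own), for which the following hold. (i) For all $n\ge1$, \[ \frac1n\sum_{k=0}^{n-1}\mathbf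 P(X_k\ne X_k^\epsilon)\le\frac{\epsilon}{\alpha+\epsilon}+\frac{1-(1-\alpha-\epsilon)^n}{n(\alpha+\epsilon)}\Big(\mathbf P(X_0\ne X_0^\epsilon)-\frac{\epsilon}{\alpha+\epsilon}\Big). \] (ii) There is a finite real-valued random variable $K$ such that, with probability one, for all $n\ge1$, \[ \frac1n\sum_{k=0}^{n-1}\mathbf 1_{\{X_k\ne X_k^\epsilon\}}\le\frac{\epsilon}{\alpha+\epsilon}+\frac Kn+2\sqrt{\frac{\log n}{n}} . \] (iii) For all $n\ge1$, with $[x]^+=\max(x,0)$, \[ \mathbf E\Big(\Big[\frac1n\sum_{k=0}^{n-1}\mathbf 1_{\{X_k\ne X_k^\epsilon\}}-\frac{\epsilon}{\alpha+\epsilon}\Big]^+\Big)^2\le\frac{2}{n^2}\frac1{(\alpha+\epsilon)^2}+\frac2n\frac{\alpha^2}{(\alpha+\epsilon)^4}. \] (iv) For all $n\ge1$ and all $\lambda>0$, \[ \mathbf P\Big(\frac1n\sum_{k=0}^{n-1}\mathbf 1_{\{X_k\ne X_k^\epsilon\}}\ge\frac{\epsilon}{\alpha+\epsilon}+\frac{\mathbf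 1_{\{X_0\ne X_0^\epsilon\}}}{n(\alpha+\epsilon)}+\frac{\lambda}{\sqrt n}\Big)\le e^{-\frac{(\alpha+\epsilon)^2}{2}\lambda^2}. \] -/

import Mathlib

open MeasureTheory ProbabilityTheory

universe u v

noncomputable section

/-- Total variation distance of two probability measures,
`(1/2) * sup { μ f - ν f : f measurable, |f| ≤ 1 }`. -/
def tvDist {E : Type u} [MeasurableSpace E] (μ ν : Measure E) : ℝ :=
  (1 / 2) * sSup {r : ℝ | ∃ f : E → ℝ, Measurable f ∧ (∀ x, |f x| ≤ 1) ∧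
    r = ∫ x, f x ∂μ - ∫ x, f x ∂ν}

/-- The σ-algebra generated by `(X 0, Y 0), …, (X n, Y n)`. -/
@[reducible] def pairPast {Ω : Type v} {E : Type u} [MeasurableSpace E] (X Y : ℕ → Ω → E) (n : ℕ) :
    MeasurableSpace Ω :=
  ⨆ k ≤ n, MeasurableSpace.comap (fun ω => (X k ω, Y k ω)) inferInstance

/-- `(X, Y)` is a coupling, on the probability space `(Ω, μ)`, of the Markov chain with transition
kernel `κ` and the Markov chain with transition kernel `η`, with initial pair of law `ν`.
The Markov property of each chain is required with respect to the common past of the pair; by the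
tower property each chain is then also Markov with respect to its own past, so that
its path law is the usual one. -/
structure IsChainCoupling {Ω : Type v} [MeasurableSpace Ω] (μ : Measure Ω)
    {E : Type u} [MeasurableSpace E] (κ η : Kernel E E) (ν : Measure (E × E))
    (X Y : ℕ → Ω → E) : Prop where
  measurable_left : ∀ n, Measurable (X n)
  measurable_right : ∀ n, Measurable (Y n)
  map_init : μ.map (fun ω => (X 0 ω, Y 0 ω)) = ν
  markov_left : ∀ (n : ℕ) (A : Set E), MeasurableSet A →
    μ[(X (n + 1) ⁻¹' A).indicator (fun _ => (1 : ℝ)) | pairPast X Y n]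
      =ᵐ[μ] fun ω => (κ (X n ω)).real A
  markov_right : ∀ (n : ℕ) (A : Set E), MeasurableSet A →
    μ[(Y (n + 1) ⁻¹' A).indicator (fun _ => (1 : ℝ)) | pairPast X Y n]
      =ᵐ[μ] fun ω => (η (Y n ω)).real A

/-- The indicator of the event that the two chains disagree at time `k`. -/
def disagree {Ω : Type v} {E : Type u} (X Y : ℕ → Ω → E) (k : ℕ) (ω : Ω) : ℝ :=
  {ω' | X k ω' ≠ Y k ω'}.indicator (fun _ => (1 : ℝ)) ω

/-- The fraction of the times `0, …, n - 1` at which the two chains disagree. -/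
def disagreeFrac {Ω : Type v} {E : Type u} (X Y : ℕ → Ω → E) (n : ℕ) (ω : Ω) : ℝ :=
  (1 / (n : ℝ)) * ∑ k ∈ Finset.range n, disagree X Y k ω

end

/-! The pair is run as one Markov chain whose step from (x, y) couples P(x,·) and Pε(y,·) so that
they differ with probability at most their total variation distance (`exists_coupling_kernel`). That
distance is at most ε when x = y and at most 1 - α otherwise. Hence the disagreement indicators D_k
have one-step predictions p_k = E[D_{k+1} | F_k] ≤ ε + (1 - α - ε) D_k, and this inequality
(`IsContractingProcess`) is all that the four estimates use.

Taking expectations gives an affine recursion with fixed point ε/(α+ε), hence (i); the contraction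
factor may be negative, so the comparison is made on partial sums (`sum_le_of_le_affine`). Pathwise,
the inequality reads (α+ε) D_k ≤ ε + (D_k - D_{k+1}) + (D_{k+1} - p_k). Summing telescopes the
middle term, so the average exceeds ε/(α+ε) by at most (M + D_0)/(n(α+ε)), where M is a sum of
martingale differences bounded by 1 (`average_sub_le`). Then (iv) is the Azuma–Hoeffding inequality
for M, (ii) its maximal form on dyadic blocks with Borel–Cantelli, and (iii) orthogonality of the
differences, each of variance at most 1/4. -/

/-! ### Total variation and measurable maximal couplings. -/

/-- The total variation distance dominates the difference of the measures of any event. -/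
theorem measureReal_sub_le_tvDist {E : Type u} [MeasurableSpace E] (μ ν : Measure E)
    [IsProbabilityMeasure μ] [IsProbabilityMeasure ν] {B : Set E} (hB : MeasurableSet B) :
    μ.real B - ν.real B ≤ tvDist μ ν := by
  have key : ∀ m : Measure E, IsProbabilityMeasure m →
      ∫ x, (B.indicator (fun _ => (2 : ℝ)) x - 1) ∂m = 2 * m.real B - 1 := by
    intro m _
    rw [integral_sub ((integrable_const _).indicator hB) (integrable_const _),
      integral_indicator_const _ hB]
    simp [mul_comm]
  have bound : ∀ m : Measure E, IsProbabilityMeasure m → ∀ f : E → ℝ, (∀ x, |f x| ≤ 1) →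
      |∫ x, f x ∂m| ≤ 1 := by
    intro m _ f hf
    simpa using norm_integral_le_of_norm_le_const (μ := m) (f := f) (C := 1)
      (Filter.Eventually.of_forall hf)
  have hle : 2 * μ.real B - 1 - (2 * ν.real B - 1) ≤
      sSup {r : ℝ | ∃ f : E → ℝ, Measurable f ∧ (∀ x, |f x| ≤ 1) ∧
        r = ∫ x, f x ∂μ - ∫ x, f x ∂ν} := by
    -- The test function is 2·1_B - 1. The bound 2 is needed because `sSup` of an unbounded set of
    -- reals is 0.
    refine le_csSup ⟨2, ?_⟩ ⟨fun x => B.indicator (fun _ => (2 : ℝ)) x - 1, ?_, ?_, ?_⟩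
    · rintro r ⟨f, -, hf, rfl⟩
      have h1 := abs_le.1 (bound μ inferInstance f hf)
      have h2 := abs_le.1 (bound ν inferInstance f hf)
      linarith [h1.2, h2.1]
    · exact (measurable_const.indicator hB).sub_const 1
    · intro x
      by_cases hx : x ∈ B
      · simp [hx]; norm_num
      · simp [hx]
    · rw [key μ inferInstance, key ν inferInstance]
  unfold tvDist
  linarith

/-- Two Markov kernels split into a common part and residual parts, the mass of the residual
part being at most the total variation distance. -/
theorem exists_kernel_common_part {α : Type u} {γ : Type v} [MeasurableSpace α] [MeasurableSpace γ]
    [MeasurableSpace.CountableOrCountablyGenerated α γ] (κ η : Kernel α γ)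
    [IsMarkovKernel κ] [IsMarkovKernel η] :
    ∃ m κ' η' : Kernel α γ, m + κ' = κ ∧ m + η' = η ∧
      ∀ a, η' a Set.univ ≤ ENNReal.ofReal (tvDist (η a) (κ a)) := by
  -- Densities with respect to κ + η, jointly measurable in the parameter and the point: this makes
  -- the pointwise minimum a kernel.
  obtain ⟨f, g, hfm, hgm, hfκ, hgη⟩ : ∃ f g : α → γ → ENNReal, Measurable (Function.uncurry f) ∧
      Measurable (Function.uncurry g) ∧ Kernel.withDensity (κ + η) f = κ ∧
      Kernel.withDensity (κ + η) g = η :=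
    ⟨fun a x => ENNReal.ofReal (Kernel.rnDerivAux κ (κ + η) a x),
      fun a x => ENNReal.ofReal (1 - Kernel.rnDerivAux κ (κ + η) a x),
      (Kernel.measurable_rnDerivAux κ (κ + η)).ennreal_ofReal,
      ((Kernel.measurable_rnDerivAux κ (κ + η)).const_sub 1).ennreal_ofReal,
      Kernel.withDensity_rnDerivAux κ η, Kernel.withDensity_one_sub_rnDerivAux κ η⟩
  have hmin : Measurable (Function.uncurry fun a x => min (f a x) (g a x)) := hfm.min hgm
  have hfg : Measurable (Function.uncurry fun a x => f a x - g a x) := hfm.sub hgm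
  have hgf : Measurable (Function.uncurry fun a x => g a x - f a x) := hgm.sub hfm
  have hsum : ∀ {h k l : α → γ → ENNReal}, Measurable (Function.uncurry h) →
      Measurable (Function.uncurry k) → Measurable (Function.uncurry l) →
      (∀ a x, h a x + k a x = l a x) →
      Kernel.withDensity (κ + η) h + Kernel.withDensity (κ + η) k
        = Kernel.withDensity (κ + η) l := by
    intro h k l hh hk hl heq
    ext a s hs
    rw [_root_.add_apply, Measure.add_apply, Kernel.withDensity_apply' _ hh,
      Kernel.withDensity_apply' _ hk, Kernel.withDensity_apply' _ hl,
      ← lintegral_add_left (show Measurable (h a) from hh.comp measurable_prodMk_left)]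
    simp_rw [heq]
  refine ⟨Kernel.withDensity (κ + η) fun a x => min (f a x) (g a x),
    Kernel.withDensity (κ + η) fun a x => f a x - g a x,
    Kernel.withDensity (κ + η) fun a x => g a x - f a x, ?_, ?_, ?_⟩
  · refine (hsum hmin hfg hfm fun a x => ?_).trans hfκ
    rcases le_total (f a x) (g a x) with h | h
    · simp [h, tsub_eq_zero_of_le h]
    · simp [h, add_tsub_cancel_of_le]
  · refine (hsum hmin hgf hgm fun a x => ?_).trans hgη
    rcases le_total (f a x) (g a x) with h | h
    · simp [h, add_tsub_cancel_of_le]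
    · simp [h, tsub_eq_zero_of_le h]
  · intro a
    -- A Hahn set: g - f lives on B, so the residual mass is η(B) - κ(B).
    set B : Set γ := {x | f a x ≤ g a x} with hB
    have hfa : Measurable (f a) := hfm.comp measurable_prodMk_left
    have hga : Measurable (g a) := hgm.comp measurable_prodMk_left
    have hBm : MeasurableSet B := measurableSet_le hfa hga
    have hfin : ∫⁻ x in B, f a x ∂(κ + η) a ≠ ⊤ := by
      rw [← Kernel.withDensity_apply' _ hfm, hfκ]
      exact measure_ne_top _ _
    have h1 : Kernel.withDensity (κ + η) (fun a x => g a x - f a x) a Set.univ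
        = η a B - κ a B := by
      rw [Kernel.withDensity_apply' _ hgf, Measure.restrict_univ,
        ← lintegral_add_compl _ hBm]
      have h2 : ∫⁻ x in Bᶜ, (g a x - f a x) ∂(κ + η) a = 0 := by
        rw [setLIntegral_congr_fun hBm.compl (g := fun _ => 0)]
        · simp
        · intro x hx
          exact tsub_eq_zero_of_le (le_of_lt (not_le.1 hx))
      rw [h2, add_zero, lintegral_sub hfa hfin
        ((ae_restrict_iff' hBm).2 (Filter.Eventually.of_forall fun x hx => hx)),
        ← Kernel.withDensity_apply' _ hfm, ← Kernel.withDensity_apply' _ hgm, hfκ, hgη]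
    rw [h1]
    refine le_trans (le_of_eq ?_) (ENNReal.ofReal_le_ofReal
      (measureReal_sub_le_tvDist (η a) (κ a) hBm))
    rw [ENNReal.ofReal_sub _ measureReal_nonneg, ofReal_measureReal, ofReal_measureReal]

/-- A measurable choice of couplings of two Markov kernels, whose disagreement probability is at
most the total variation distance. -/
theorem exists_coupling_kernel {α : Type u} {γ : Type v} [MeasurableSpace α] [MeasurableSpace γ]
    [MeasurableSpace.CountableOrCountablyGenerated α γ]
    (hdiag : MeasurableSet {p : γ × γ | p.1 ≠ p.2}) (κ η : Kernel α γ)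
    [IsMarkovKernel κ] [IsMarkovKernel η] :
    ∃ Q : Kernel α (γ × γ), IsMarkovKernel Q ∧
      (∀ a A, MeasurableSet A → Q a (Prod.fst ⁻¹' A) = κ a A) ∧
      (∀ a A, MeasurableSet A → Q a (Prod.snd ⁻¹' A) = η a A) ∧
      ∀ a, Q a {p | p.1 ≠ p.2} ≤ ENNReal.ofReal (tvDist (η a) (κ a)) := by
  obtain ⟨m, κ', η', hκ, hη, htv⟩ := exists_kernel_common_part κ η
  have hκa : ∀ a s, m a s + κ' a s = κ a s := fun a s => by
    rw [← Measure.add_apply, ← _root_.add_apply, hκ]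
  have hηa : ∀ a s, m a s + η' a s = η a s := fun a s => by
    rw [← Measure.add_apply, ← _root_.add_apply, hη]
  have hκ' : IsFiniteKernel κ' := ⟨1, ENNReal.one_lt_top, fun a => by
    rw [← measure_univ (μ := κ a), ← hκa]; exact le_add_self⟩
  have hη' : IsFiniteKernel η' := ⟨1, ENNReal.one_lt_top, fun a => by
    rw [← measure_univ (μ := η a), ← hηa]; exact le_add_self⟩
  have hm : IsFiniteKernel m := ⟨1, ENNReal.one_lt_top, fun a => by
    rw [← measure_univ (μ := η a), ← hηa]; exact le_self_add⟩
  have hmass : ∀ a, κ' a Set.univ = η' a Set.univ := fun a => by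
    have h : m a Set.univ + κ' a Set.univ = m a Set.univ + η' a Set.univ := by
      rw [hκa, hηa, measure_univ, measure_univ]
    exact (ENNReal.add_right_inj (measure_ne_top _ _)).1 h
  have hdens : Measurable (Function.uncurry fun (a : α) (_ : γ × γ) => (η' a Set.univ)⁻¹) :=
    ((Kernel.measurable_coe η' MeasurableSet.univ).comp measurable_fst).inv
  have hd : Measurable (fun x : γ => (x, x)) := by fun_prop
  -- The common part is put on the diagonal, the two residuals are taken independent; they have
  -- equal mass, and dividing their product by it restores both marginals. If that mass is 0 the
  -- factor is ⊤, but it multiplies the zero measure.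
  set Q : Kernel α (γ × γ) := m.map (fun x => (x, x)) +
    Kernel.withDensity (κ' ×ₖ η') (fun a _ => (η' a Set.univ)⁻¹) with hQdef
  have hQ : ∀ a s, MeasurableSet s →
      Q a s = m a {x | (x, x) ∈ s} + (η' a Set.univ)⁻¹ * (κ' ×ₖ η') a s := by
    intro a s hs
    rw [hQdef, _root_.add_apply, Measure.add_apply, Kernel.map_apply' _ hd _ hs,
      Kernel.withDensity_apply' _ hdens, setLIntegral_const]
    rfl
  have hcancel : ∀ b c : ENNReal, c ≠ ⊤ → b ≤ c → c⁻¹ * (b * c) = b := by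
    intro b c hc hbc
    rcases eq_or_ne c 0 with h0 | h0
    · simp [h0, nonpos_iff_eq_zero.1 (h0 ▸ hbc)]
    · rw [mul_comm, mul_assoc, ENNReal.mul_inv_cancel h0 hc, mul_one]
  have hfst : ∀ a A, MeasurableSet A → Q a (Prod.fst ⁻¹' A) = κ a A := by
    intro a A hA
    rw [hQ a _ (measurable_fst hA), ← Set.prod_univ, Kernel.prod_apply_prod,
      hcancel _ _ (measure_ne_top _ _) ((measure_mono (Set.subset_univ A)).trans_eq (hmass a)),
      ← hκa]
    simp
  have hsnd : ∀ a A, MeasurableSet A → Q a (Prod.snd ⁻¹' A) = η a A := by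
    intro a A hA
    rw [hQ a _ (measurable_snd hA), ← Set.univ_prod, Kernel.prod_apply_prod, hmass a,
      mul_comm (η' a Set.univ) (η' a A),
      hcancel _ _ (measure_ne_top _ _) (measure_mono (Set.subset_univ A)), ← hηa]
    simp
  refine ⟨Q, ⟨fun a => ⟨?_⟩⟩, hfst, hsnd, fun a => ?_⟩
  · rw [← Set.preimage_univ (f := Prod.fst), hfst a _ MeasurableSet.univ, measure_univ]
  · rw [hQ a _ hdiag]
    have h0 : {x : γ | (x, x) ∈ {p : γ × γ | p.1 ≠ p.2}} = ∅ := by ext; simp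
    rw [h0, measure_empty, zero_add]
    calc (η' a Set.univ)⁻¹ * (κ' ×ₖ η') a {p | p.1 ≠ p.2}
        ≤ (η' a Set.univ)⁻¹ * (κ' ×ₖ η') a (Set.univ ×ˢ Set.univ) := by
          gcongr
          simp
      _ = η' a Set.univ := by
          rw [Kernel.prod_apply_prod, hmass a, hcancel _ _ (measure_ne_top _ _) le_rfl]
      _ ≤ _ := htv a

/-! ### Bounded martingale differences: exponential, maximal and second moment bounds. -/

/-- A real martingale difference sequence bounded by `1`. -/
structure IsBoundedMartingaleDiff {Ω : Type v} {mΩ : MeasurableSpace Ω} (μ : Measure Ω)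
    (ℱ : Filtration ℕ mΩ) (ξ : ℕ → Ω → ℝ) : Prop where
  measurable : ∀ k, Measurable[ℱ (k + 1)] (ξ k)
  abs_le_one : ∀ k ω, |ξ k ω| ≤ 1
  condExp_eq_zero : ∀ k, μ[ξ k | ℱ k] =ᵐ[μ] 0

namespace IsBoundedMartingaleDiff

variable {Ω : Type v} {mΩ : MeasurableSpace Ω} {μ : Measure Ω}
  {ℱ : Filtration ℕ mΩ} {ξ : ℕ → Ω → ℝ}

theorem measurable_ambient (h : IsBoundedMartingaleDiff μ ℱ ξ) (k : ℕ) : Measurable (ξ k) :=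
  (h.measurable k).mono (ℱ.le _) le_rfl

theorem measurable_sum (h : IsBoundedMartingaleDiff μ ℱ ξ) (n : ℕ) :
    Measurable[ℱ n] fun ω => ∑ k ∈ Finset.range n, ξ k ω :=
  Finset.measurable_fun_sum _ fun k hk =>
    (h.measurable k).mono (ℱ.mono (Finset.mem_range.1 hk)) le_rfl

theorem abs_sum_le (h : IsBoundedMartingaleDiff μ ℱ ξ) (n : ℕ) (ω : Ω) :
    |∑ k ∈ Finset.range n, ξ k ω| ≤ n := by
  refine (Finset.abs_sum_le_sum_abs _ _).trans ?_
  simpa using Finset.sum_le_card_nsmul (Finset.range n) (fun k => |ξ k ω|) 1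
    fun k _ => h.abs_le_one k ω

theorem measurable_exp_sum (h : IsBoundedMartingaleDiff μ ℱ ξ) (t : ℝ) (n : ℕ) :
    Measurable[ℱ n] fun ω => Real.exp (t * ∑ k ∈ Finset.range n, ξ k ω) :=
  ((h.measurable_sum n).const_mul t).exp

theorem abs_exp_sum_le (h : IsBoundedMartingaleDiff μ ℱ ξ) (t : ℝ) (n : ℕ) (ω : Ω) :
    |Real.exp (t * ∑ k ∈ Finset.range n, ξ k ω)| ≤ Real.exp (|t| * n) := by
  rw [abs_of_pos (Real.exp_pos _), Real.exp_le_exp]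
  calc t * ∑ k ∈ Finset.range n, ξ k ω ≤ |t * ∑ k ∈ Finset.range n, ξ k ω| := le_abs_self _
    _ = |t| * |∑ k ∈ Finset.range n, ξ k ω| := abs_mul _ _
    _ ≤ |t| * n := mul_le_mul_of_nonneg_left (h.abs_sum_le n ω) (abs_nonneg t)

variable [IsProbabilityMeasure μ]

theorem integrable_of_bounded {f : Ω → ℝ} (hf : Measurable f) (C : ℝ) (hC : ∀ ω, |f ω| ≤ C) :
    Integrable f μ :=
  Integrable.of_bound hf.aestronglyMeasurable C (Filter.Eventually.of_forall hC)

theorem integrable (h : IsBoundedMartingaleDiff μ ℱ ξ) (k : ℕ) : Integrable (ξ k) μ :=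
  integrable_of_bounded (h.measurable_ambient k) 1 (h.abs_le_one k)

/-- A martingale difference is orthogonal to every bounded function of the past. -/
theorem integral_mul_eq_zero (h : IsBoundedMartingaleDiff μ ℱ ξ) (k : ℕ) {Z : Ω → ℝ}
    (hZ : Measurable[ℱ k] Z) (C : ℝ) (hC : ∀ ω, |Z ω| ≤ C) : ∫ ω, Z ω * ξ k ω ∂μ = 0 := by
  have h1 := condExp_stronglyMeasurable_mul_of_bound (ℱ.le k) hZ.stronglyMeasurable
    (h.integrable k) C (Filter.Eventually.of_forall hC)
  calc ∫ ω, Z ω * ξ k ω ∂μ = ∫ ω, (μ[Z * ξ k | ℱ k]) ω ∂μ := (integral_condExp (ℱ.le k)).symm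
    _ = ∫ _, (0 : ℝ) ∂μ := by
      refine integral_congr_ae ?_
      filter_upwards [h1, h.condExp_eq_zero k] with ω h1 h2
      simp [h1, h2]
    _ = 0 := by simp

theorem integrable_mul (h : IsBoundedMartingaleDiff μ ℱ ξ) (k : ℕ) {Z : Ω → ℝ}
    (hZ : Measurable[ℱ k] Z) (C : ℝ) (hC : ∀ ω, |Z ω| ≤ C) :
    Integrable (fun ω => Z ω * ξ k ω) μ := by
  refine integrable_of_bounded ((hZ.mono (ℱ.le k) le_rfl).mul (h.measurable_ambient k)) C
    fun ω => ?_
  rw [abs_mul]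
  have h1 := hC ω
  have h2 := h.abs_le_one k ω
  nlinarith [abs_nonneg (Z ω), abs_nonneg (ξ k ω)]

theorem integrable_exp_sum (h : IsBoundedMartingaleDiff μ ℱ ξ) (t : ℝ) (n : ℕ) :
    Integrable (fun ω => Real.exp (t * ∑ k ∈ Finset.range n, ξ k ω)) μ :=
  integrable_of_bounded ((h.measurable_exp_sum t n).mono (ℱ.le n) le_rfl) _ (h.abs_exp_sum_le t n)

/-- By convexity exp(tξ) ≤ cosh t + ξ sinh t for |ξ| ≤ 1; the linear term is orthogonal to the past,
and cosh t ≤ exp(t²/2). -/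
theorem integral_exp_sum_le (h : IsBoundedMartingaleDiff μ ℱ ξ) (t : ℝ) (n : ℕ) :
    ∫ ω, Real.exp (t * ∑ k ∈ Finset.range n, ξ k ω) ∂μ ≤ Real.exp (t ^ 2 * n / 2) := by
  induction n with
  | zero => simp
  | succ n ih =>
    set W : Ω → ℝ := fun ω => Real.exp (t * ∑ k ∈ Finset.range n, ξ k ω) with hW
    have hWξ := h.integrable_mul n (h.measurable_exp_sum t n) _ (h.abs_exp_sum_le t n)
    calc ∫ ω, Real.exp (t * ∑ k ∈ Finset.range (n + 1), ξ k ω) ∂μ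
        ≤ ∫ ω, (Real.cosh t * W ω + Real.sinh t * (W ω * ξ n ω)) ∂μ := by
          refine integral_mono (h.integrable_exp_sum t (n + 1))
            (((h.integrable_exp_sum t n).const_mul _).add (hWξ.const_mul _)) fun ω => ?_
          have h1 := Real.exp_mul_le_cosh_add_mul_sinh (h.abs_le_one n ω) t
          have h2 : 0 ≤ W ω := (Real.exp_pos _).le
          simp only [Finset.sum_range_succ, mul_add, Real.exp_add]
          rw [mul_comm t (ξ n ω)]
          calc W ω * Real.exp (ξ n ω * t) ≤ W ω * (Real.cosh t + ξ n ω * Real.sinh t) :=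
                mul_le_mul_of_nonneg_left h1 h2
            _ = _ := by ring
      _ = Real.cosh t * ∫ ω, W ω ∂μ := by
          rw [integral_add ((h.integrable_exp_sum t n).const_mul _) (hWξ.const_mul _),
            integral_const_mul, integral_const_mul,
            h.integral_mul_eq_zero n (h.measurable_exp_sum t n) _ (h.abs_exp_sum_le t n)]
          ring
      _ ≤ Real.exp (t ^ 2 / 2) * Real.exp (t ^ 2 * n / 2) :=
          mul_le_mul (Real.cosh_le_exp_half_sq t) ih
            (integral_nonneg fun ω => (Real.exp_pos _).le) (Real.exp_pos _).le
      _ = Real.exp (t ^ 2 * ((n + 1 : ℕ) : ℝ) / 2) := by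
          rw [← Real.exp_add]
          push_cast
          ring_nf

/-- Since exp(tξ) ≥ 1 + tξ, and the linear term integrates to 0 against any bounded function of the
past. This is the input to Doob's maximal inequality. -/
theorem submartingale_exp_sum (h : IsBoundedMartingaleDiff μ ℱ ξ) (t : ℝ) :
    Submartingale (fun n ω => Real.exp (t * ∑ k ∈ Finset.range n, ξ k ω)) ℱ μ := by
  refine submartingale_of_setIntegral_le_succ
    (fun n => (h.measurable_exp_sum t n).stronglyMeasurable) (h.integrable_exp_sum t)
    fun n s hs => ?_
  set W : Ω → ℝ := fun ω => Real.exp (t * ∑ k ∈ Finset.range n, ξ k ω) with hW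
  have hWm : Measurable[ℱ n] W := h.measurable_exp_sum t n
  have hsW : Measurable[ℱ n] (s.indicator W) := hWm.indicator hs
  have hsC : ∀ ω, |s.indicator W ω| ≤ Real.exp (|t| * n) := fun ω => by
    by_cases hω : ω ∈ s
    · rw [Set.indicator_of_mem hω]
      exact h.abs_exp_sum_le t n ω
    · simpa [hω] using (Real.exp_pos _).le
  have hs' : MeasurableSet s := ℱ.le n _ hs
  have h0 := h.integral_mul_eq_zero n hsW _ hsC
  have hi := h.integrable_mul n hsW _ hsC
  rw [← integral_indicator hs', ← integral_indicator hs']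
  calc ∫ ω, s.indicator W ω ∂μ = ∫ ω, (s.indicator W ω + t * (s.indicator W ω * ξ n ω)) ∂μ := by
        rw [integral_add ((h.integrable_exp_sum t n).indicator hs') (hi.const_mul t),
          integral_const_mul, h0]
        ring
    _ ≤ _ := by
        refine integral_mono (((h.integrable_exp_sum t n).indicator hs').add (hi.const_mul t))
          ((h.integrable_exp_sum t (n + 1)).indicator hs') fun ω => ?_
        by_cases hω : ω ∈ s
        · have h1 := Real.add_one_le_exp (t * ξ n ω)
          have h2 : 0 ≤ W ω := (Real.exp_pos _).le
          simp only [hω, Set.indicator_of_mem, Finset.sum_range_succ, mul_add, Real.exp_add]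
          calc W ω + t * (W ω * ξ n ω) = W ω * (t * ξ n ω + 1) := by ring
            _ ≤ _ := mul_le_mul_of_nonneg_left h1 h2
        · simp [hω]

/-- Maximal form of the Azuma–Hoeffding inequality. -/
theorem measureReal_exists_le_sum (h : IsBoundedMartingaleDiff μ ℱ ξ) {n : ℕ} (hn : 0 < n)
    {x : ℝ} (hx : 0 ≤ x) :
    μ.real {ω | ∃ m ≤ n, x ≤ ∑ k ∈ Finset.range m, ξ k ω} ≤ Real.exp (-(x ^ 2 / (2 * n))) := by
  have hn' : (0 : ℝ) < n := by exact_mod_cast hn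
  -- The minimiser of t²n/2 - tx.
  set t : ℝ := x / n with ht
  have ht0 : 0 ≤ t := by positivity
  set f : ℕ → Ω → ℝ := fun n ω => Real.exp (t * ∑ k ∈ Finset.range n, ξ k ω) with hf
  set c : NNReal := ⟨Real.exp (t * x), (Real.exp_pos _).le⟩ with hc
  set A : Set Ω := {ω | (c : ℝ) ≤ (Finset.range (n + 1)).sup' Finset.nonempty_range_add_one
    fun k => f k ω} with hA
  have hmax := maximal_ineq (h.submartingale_exp_sum t)
    (fun n ω => (Real.exp_pos _).le) (ε := c) n
  have hsub : {ω | ∃ m ≤ n, x ≤ ∑ k ∈ Finset.range m, ξ k ω} ⊆ A := by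
    rintro ω ⟨m, hm, hxm⟩
    refine le_trans ?_ (Finset.le_sup' (fun k => f k ω) (Finset.mem_range.2 (Nat.lt_succ_of_le hm)))
    exact Real.exp_le_exp.2 (mul_le_mul_of_nonneg_left hxm ht0)
  have h1 : Real.exp (t * x) * μ.real A ≤ Real.exp (t ^ 2 * n / 2) := by
    have h2 : ∫ ω in A, f n ω ∂μ ≤ Real.exp (t ^ 2 * n / 2) :=
      (setIntegral_le_integral (h.integrable_exp_sum t n)
        (Filter.Eventually.of_forall fun ω => (Real.exp_pos _).le)).trans
        (h.integral_exp_sum_le t n)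
    have h3 := ENNReal.toReal_mono ENNReal.ofReal_ne_top
      (hmax.trans (ENNReal.ofReal_le_ofReal h2))
    rwa [ENNReal.toReal_mul, ENNReal.toReal_ofReal (Real.exp_pos _).le] at h3
  calc _ ≤ μ.real A := measureReal_mono hsub
    _ = Real.exp (-(t * x)) * (Real.exp (t * x) * μ.real A) := by
        rw [← mul_assoc, ← Real.exp_add]; simp
    _ ≤ Real.exp (-(t * x)) * Real.exp (t ^ 2 * n / 2) :=
        mul_le_mul_of_nonneg_left h1 (Real.exp_pos _).le
    _ = _ := by
        rw [← Real.exp_add, ht]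
        congr 1
        field_simp
        ring

/-- Almost surely a martingale with bounded increments exceeds any multiple of `√(n log n)` by at
most a bounded amount. -/
theorem ae_exists_sum_le (h : IsBoundedMartingaleDiff μ ℱ ξ) {c : ℝ} (hc : 0 < c) :
    ∀ᵐ ω ∂μ, ∃ B : ℝ, 0 ≤ B ∧ ∀ n : ℕ,
      ∑ k ∈ Finset.range n, ξ k ω ≤ c * Real.sqrt (n * Real.log n) + B := by
  -- Level for the block 2^j ≤ n < 2^(j+1). The maximal inequality up to 2^(j+1) gives probability
  -- exp(-c² j log 2 / 4) = r^j, summable for every c > 0.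
  set x : ℕ → ℝ := fun j => c * Real.sqrt (2 ^ j * (j * Real.log 2)) with hx
  have hlog2 : 0 < Real.log 2 := Real.log_pos (by norm_num)
  set A : ℕ → Set Ω := fun j => {ω | ∃ m ≤ 2 ^ (j + 1), x j ≤ ∑ k ∈ Finset.range m, ξ k ω} with hA
  set r : ℝ := Real.exp (-(c ^ 2 * Real.log 2 / 4)) with hr
  have hr1 : r < 1 := Real.exp_lt_one_iff.2 (neg_neg_of_pos (by positivity))
  have hbound : ∀ j, μ (A j) ≤ ENNReal.ofReal (r ^ j) := by
    intro j
    rw [← ofReal_measureReal]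
    refine ENNReal.ofReal_le_ofReal ((h.measureReal_exists_le_sum (n := 2 ^ (j + 1))
      (by positivity) (x := x j) (by positivity)).trans (le_of_eq ?_))
    rw [hr, ← Real.exp_nat_mul, hx]
    congr 1
    simp only [mul_pow]
    rw [Real.sq_sqrt (by positivity)]
    push_cast
    field_simp
    ring
  have hsum : ∑' j, μ (A j) ≠ ⊤ := by
    refine ne_top_of_le_ne_top ?_ (ENNReal.tsum_le_tsum hbound)
    rw [← ENNReal.ofReal_tsum_of_nonneg (fun j => pow_nonneg (Real.exp_pos _).le j)
      (summable_geometric_of_lt_one (Real.exp_pos _).le hr1)]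
    exact ENNReal.ofReal_ne_top
  filter_upwards [ae_eventually_notMem hsum] with ω hω
  obtain ⟨J, hJ⟩ := Filter.eventually_atTop.1 hω
  -- Before the last exceptional block the trivial bound |sum| ≤ n suffices.
  refine ⟨2 ^ J, by positivity, fun n => ?_⟩
  rcases lt_or_ge n (2 ^ J) with hn | hn
  · have h1 := (le_abs_self _).trans (h.abs_sum_le n ω)
    have h2 : (n : ℝ) ≤ 2 ^ J := by exact_mod_cast hn.le
    have h3 : 0 ≤ c * Real.sqrt (n * Real.log n) := by positivity
    linarith
  · have hn0 : n ≠ 0 := by have := Nat.one_le_two_pow (n := J); omega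
    have hj : J ≤ Nat.log 2 n := Nat.le_log_of_pow_le (by norm_num) hn
    have h1 : ∑ k ∈ Finset.range n, ξ k ω < x (Nat.log 2 n) := by
      by_contra! hcon
      exact hJ _ hj ⟨n, (Nat.lt_pow_succ_log_self (by norm_num) n).le, hcon⟩
    have h2 : ((2 : ℝ) ^ Nat.log 2 n) ≤ n := by exact_mod_cast Nat.pow_log_le_self 2 hn0
    have h3 : (Nat.log 2 n : ℝ) * Real.log 2 ≤ Real.log n := by
      rw [← Real.log_pow]
      exact Real.log_le_log (by positivity) h2
    have h4 : x (Nat.log 2 n) ≤ c * Real.sqrt (n * Real.log n) := by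
      simp only [hx]
      gcongr
    have h5 : (0 : ℝ) ≤ 2 ^ J := by positivity
    linarith

theorem integral_sum_sq_le (h : IsBoundedMartingaleDiff μ ℱ ξ) {v : ℝ}
    (hv : ∀ k, ∫ ω, ξ k ω ^ 2 ∂μ ≤ v) (n : ℕ) :
    ∫ ω, (∑ k ∈ Finset.range n, ξ k ω) ^ 2 ∂μ ≤ n * v := by
  induction n with
  | zero => simp
  | succ n ih =>
    have h1 := h.integral_mul_eq_zero n (h.measurable_sum n) n (h.abs_sum_le n)
    have i1 := h.integrable_mul n (h.measurable_sum n) n (h.abs_sum_le n)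
    have i2 : Integrable (fun ω => (∑ k ∈ Finset.range n, ξ k ω) ^ 2) μ :=
      integrable_of_bounded (((h.measurable_sum n).mono (ℱ.le n) le_rfl).pow_const 2) (n ^ 2)
        fun ω => by rw [abs_pow]; gcongr; exact h.abs_sum_le n ω
    have i3 : Integrable (fun ω => ξ n ω ^ 2) μ :=
      integrable_of_bounded ((h.measurable_ambient n).pow_const 2) (1 ^ 2)
        fun ω => by rw [abs_pow]; gcongr; exact h.abs_le_one n ω
    calc ∫ ω, (∑ k ∈ Finset.range (n + 1), ξ k ω) ^ 2 ∂μ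
        = ∫ ω, ((∑ k ∈ Finset.range n, ξ k ω) ^ 2 +
            2 * ((∑ k ∈ Finset.range n, ξ k ω) * ξ n ω) + ξ n ω ^ 2) ∂μ := by
          refine integral_congr_ae (Filter.Eventually.of_forall fun ω => ?_)
          simp only [Finset.sum_range_succ]
          ring
      _ = ∫ ω, (∑ k ∈ Finset.range n, ξ k ω) ^ 2 ∂μ + ∫ ω, ξ n ω ^ 2 ∂μ := by
          have h2 : ∫ ω, ((∑ k ∈ Finset.range n, ξ k ω) ^ 2 +
              2 * ((∑ k ∈ Finset.range n, ξ k ω) * ξ n ω)) ∂μ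
              = ∫ ω, (∑ k ∈ Finset.range n, ξ k ω) ^ 2 ∂μ := by
            rw [integral_add i2 (i1.const_mul 2), integral_const_mul, h1]
            ring
          rw [← h2]
          exact integral_add (i2.add (i1.const_mul 2)) i3
      _ ≤ n * v + v := add_le_add ih (hv n)
      _ = _ := by push_cast; ring

end IsBoundedMartingaleDiff

/-! ### The canonical chain on path space. -/

/-- Existence of the Markov chain with transition kernel `Q` and initial law `ν` on path space. -/
theorem exists_markovChain_measure {S : Type u} [MeasurableSpace S] (Q : Kernel S S)
    [IsMarkovKernel Q] (ν : Measure S) [IsProbabilityMeasure ν] :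
    ∃ μ : Measure (ℕ → S), IsProbabilityMeasure μ ∧ μ.map (fun ω => ω 0) = ν ∧
      ∀ (n : ℕ) (B : Set S), MeasurableSet B →
        μ[((fun ω : ℕ → S => ω (n + 1)) ⁻¹' B).indicator (fun _ => (1 : ℝ)) |
          Filtration.piLE (X := fun _ : ℕ => S) n] =ᵐ[μ] fun ω => (Q (ω n)).real B := by
  have hev : ∀ n : ℕ, Measurable fun h : (i : Finset.Iic n) → S => h ⟨n, by simp⟩ :=
    fun n => measurable_pi_apply _
  set κ : (n : ℕ) → Kernel ((i : Finset.Iic n) → S) S := fun n => Q.comap _ (hev n) with hκ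
  set μ : Measure (ℕ → S) := Kernel.trajMeasure (X := fun _ => S) ν κ with hμ
  refine ⟨μ, inferInstance, ?_, fun n B hB => ?_⟩
  · have h1 : (fun ω : ℕ → S => ω 0) =
        (fun h : (i : Finset.Iic 0) → S => h ⟨0, by simp⟩) ∘
          Preorder.frestrictLe (π := fun _ : ℕ => S) 0 := rfl
    rw [h1, ← Measure.map_map (hev 0) (Preorder.measurable_frestrictLe 0), hμ, Kernel.trajMeasure,
      Measure.map_comp _ _ (Preorder.measurable_frestrictLe 0), Kernel.traj_map_frestrictLe,
      Kernel.partialTraj_self, Measure.id_comp, Measure.map_map (hev 0) (by fun_prop)]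
    exact Measure.map_id
  · have hBm : MeasurableSet ((fun ω : ℕ → S => ω (n + 1)) ⁻¹' B) := measurable_pi_apply _ hB
    have hQB : Measurable fun x => (Q x).real B := (Kernel.measurable_coe Q hB).ennreal_toReal
    have hpi : Filtration.piLE (X := fun _ : ℕ => S) n =
        MeasurableSpace.pi.comap (Preorder.frestrictLe n) := Filtration.piLE_eq_comap_frestrictLe n
    have hint : Integrable (fun ω : ℕ → S => (Q (ω n)).real B) μ :=
      Integrable.of_bound (hQB.comp (measurable_pi_apply n)).aestronglyMeasurable 1
        (Filter.Eventually.of_forall fun ω => by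
          rw [Real.norm_of_nonneg measureReal_nonneg]; exact measureReal_le_one)
    refine (ae_eq_condExp_of_forall_setIntegral_eq (Filtration.piLE.le n)
      ((integrable_const _).indicator hBm) (fun s _ _ => hint.integrableOn) ?_ ?_).symm
    · intro s hs _
      rw [hpi] at hs
      obtain ⟨t, ht, rfl⟩ := hs
      -- The joint law of the past and the next state is past law ⊗ kernel; evaluating it on t ×ˢ B
      -- is the defining identity of the conditional expectation.
      have hcomp := Kernel.map_frestrictLe_trajMeasure_compProd_eq_map_trajMeasure
        (X := fun _ => S) (μ₀ := ν) (κ := κ) (a := n)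
      have h1 := congrArg (fun m => m (t ×ˢ B)) hcomp
      have hfr : Measurable (Preorder.frestrictLe (π := fun _ : ℕ => S) n) :=
        Preorder.measurable_frestrictLe n
      rw [Measure.compProd_apply_prod ht hB, Measure.map_apply (by fun_prop) (ht.prod hB),
        setLIntegral_map ht (Kernel.measurable_coe _ hB) hfr] at h1
      rw [setIntegral_indicator hBm, setIntegral_const, smul_eq_mul, mul_one,
        integral_eq_lintegral_of_nonneg_ae
          (Filter.Eventually.of_forall fun ω => measureReal_nonneg)
          hint.aestronglyMeasurable.restrict]
      have hof : ∀ ω : ℕ → S, ENNReal.ofReal ((Q (ω n)).real B) = Q (ω n) B :=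
        fun ω => ofReal_measureReal
      simp only [hof]
      exact congrArg ENNReal.toReal h1
    · refine Measurable.aestronglyMeasurable ?_
      refine hQB.comp ?_
      rw [hpi]
      exact (hev n).comp (comap_measurable _)

theorem pairPast_eval_eq_piLE {E : Type u} [MeasurableSpace E] (n : ℕ) :
    pairPast (fun k (ω : ℕ → E × E) => (ω k).1) (fun k ω => (ω k).2) n =
      Filtration.piLE (X := fun _ : ℕ => E × E) n := by
  rw [Filtration.piLE_eq_comap_frestrictLe]
  refine le_antisymm (iSup₂_le fun k hk => ?_) ?_
  · refine Measurable.comap_le ?_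
    exact (measurable_pi_apply (⟨k, Finset.mem_Iic.2 hk⟩ : Finset.Iic n)).comp
      (comap_measurable (Preorder.frestrictLe (π := fun _ : ℕ => E × E) n))
  · refine Measurable.comap_le (@measurable_pi_lambda _ _ _ (_) _ _ fun i => ?_)
    refine Measurable.mono (comap_measurable (fun ω : ℕ → E × E => ω i)) ?_ le_rfl
    exact le_iSup₂_of_le (f := fun k (_ : k ≤ n) => MeasurableSpace.comap
      (fun ω : ℕ → E × E => ((ω k).1, (ω k).2)) inferInstance) (i : ℕ) (Finset.mem_Iic.1 i.2) le_rfl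

/-! ### Deterministic inequalities. -/

/-- Pathwise comparison of an occupation time with its martingale part. -/
theorem mul_sum_le_sum_sub_add {α ε : ℝ} (hα1 : α ≤ 1) (hε0 : 0 ≤ ε) {D p : ℕ → ℝ}
    (hD0 : ∀ k, 0 ≤ D k) (hD1 : ∀ k, D k ≤ 1) (hp : ∀ k, p k ≤ ε + (1 - α - ε) * D k) (n : ℕ) :
    (α + ε) * ∑ k ∈ Finset.range (n + 1), D k ≤
      ∑ k ∈ Finset.range n, (D (k + 1) - p k) + D 0 + (n + 1) * ε := by
  -- Keeping -D n lets the last summand be absorbed afterwards: (α + ε - 1) D n ≤ ε because D n ∈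
  -- [0, 1] and α ≤ 1.
  have key : ∀ n : ℕ, (α + ε) * ∑ k ∈ Finset.range n, D k ≤
      ∑ k ∈ Finset.range n, (D (k + 1) - p k) + D 0 - D n + n * ε := by
    intro n
    induction n with
    | zero => simp
    | succ n ih =>
      rw [Finset.sum_range_succ, Finset.sum_range_succ]
      push_cast
      linarith [hp n]
  rw [Finset.sum_range_succ]
  nlinarith [key n, hD0 n, hD1 n]

/-- A sequence contracting towards `ε / (α + ε)` has Cesàro sums dominated by those of the exact
recursion, even when the contraction factor `1 - α - ε` is negative. -/
theorem sum_le_of_le_affine {α ε : ℝ} (hα1 : α < 1) (hε0 : 0 < ε) (hεα : ε < α) {q : ℕ → ℝ}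
    (hq : ∀ k, q (k + 1) ≤ ε + (1 - α - ε) * q k) (n : ℕ) :
    ∑ k ∈ Finset.range n, q k ≤
      n * (ε / (α + ε)) + (1 - (1 - α - ε) ^ n) / (α + ε) * (q 0 - ε / (α + ε)) := by
  have ha : 0 < α + ε := by linarith
  set ρ : ℝ := 1 - α - ε with hρ
  set w : ℝ := ε / (α + ε) with hw
  have hwa : ε = w * (1 - ρ) := by rw [hw, hρ]; field_simp; ring
  set d : ℕ → ℝ := fun k => w + ρ ^ k * (q 0 - w) - q k with hd
  have hd0 : d 0 = 0 := by simp [hd]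
  have hdS : ∀ k, ρ * d k ≤ d (k + 1) := by
    intro k
    simp only [hd, pow_succ]
    nlinarith [hq k]
  have hG : ∀ n, 0 ≤ ∑ k ∈ Finset.range n, d k ∧ 0 ≤ ∑ k ∈ Finset.range (n + 1), d k := by
    rcases le_total 0 ρ with h | h
    · have hdk : ∀ k, 0 ≤ d k := by
        intro k
        induction k with
        | zero => exact hd0.ge
        | succ k ih => exact (mul_nonneg h ih).trans (hdS k)
      exact fun n => ⟨Finset.sum_nonneg fun k _ => hdk k, Finset.sum_nonneg fun k _ => hdk k⟩
    -- For ρ ≤ 0 the d k may change sign, but the partial sums G satisfy G(n+2) ≥ (1+ρ) G(n+1) +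
    -- (-ρ) G(n) with both coefficients nonnegative; hence induction on consecutive pairs.
    · intro n
      induction n with
      | zero => simp [hd0]
      | succ n ih =>
        refine ⟨ih.2, ?_⟩
        have h1 := hdS n
        have h2 : 0 ≤ 1 + ρ := by rw [hρ]; linarith
        have h3 := mul_nonneg h2 ih.2
        have h4 := mul_nonneg (neg_nonneg.2 h) ih.1
        rw [Finset.sum_range_succ, Finset.sum_range_succ] at *
        nlinarith
  have h1 := (hG n).1
  have h2 : ∑ k ∈ Finset.range n, ρ ^ k = (1 - ρ ^ n) / (α + ε) := by
    rw [geom_sum_eq (by rw [hρ]; linarith), ← neg_div_neg_eq]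
    congr 1 <;> rw [hρ] <;> ring
  simp only [hd, Finset.sum_sub_distrib, Finset.sum_add_distrib, ← Finset.sum_mul, h2] at h1
  simp only [Finset.sum_const, Finset.card_range, nsmul_eq_mul] at h1
  linarith

/-! ### Estimates for contracting processes. -/

/-- An adapted `[0, 1]`-valued process `D` whose one-step predictions `p` satisfy
`p k ≤ ε + (1 - α - ε) * D k`. -/
structure IsContractingProcess {Ω : Type v} {mΩ : MeasurableSpace Ω} (μ : Measure Ω)
    (ℱ : Filtration ℕ mΩ) (α ε : ℝ) (D p : ℕ → Ω → ℝ) : Prop where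
  measurable : ∀ k, Measurable[ℱ k] (D k)
  measurable_pred : ∀ k, Measurable[ℱ k] (p k)
  nonneg : ∀ k ω, 0 ≤ D k ω
  le_one : ∀ k ω, D k ω ≤ 1
  pred_nonneg : ∀ k ω, 0 ≤ p k ω
  pred_le_one : ∀ k ω, p k ω ≤ 1
  condExp_eq : ∀ k, μ[D (k + 1) | ℱ k] =ᵐ[μ] p k
  pred_le : ∀ k ω, p k ω ≤ ε + (1 - α - ε) * D k ω

namespace IsContractingProcess

variable {Ω : Type v} {mΩ : MeasurableSpace Ω} {μ : Measure Ω}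
  {ℱ : Filtration ℕ mΩ} {α ε : ℝ} {D p : ℕ → Ω → ℝ}

theorem average_sub_le (h : IsContractingProcess μ ℱ α ε D p) (hα0 : 0 < α) (hα1 : α < 1)
    (hε0 : 0 < ε) {n : ℕ} (hn : 1 ≤ n) (ω : Ω) :
    1 / (n : ℝ) * ∑ k ∈ Finset.range n, D k ω - ε / (α + ε) ≤
      (∑ k ∈ Finset.range (n - 1), (D (k + 1) ω - p k ω) + D 0 ω) / (n * (α + ε)) := by
  have ha : 0 < α + ε := by linarith
  have hn' : (0 : ℝ) < n := by exact_mod_cast hn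
  obtain ⟨m, rfl⟩ : ∃ m, n = m + 1 := ⟨n - 1, by omega⟩
  have h1 := mul_sum_le_sum_sub_add hα1.le hε0.le (D := fun k => D k ω) (p := fun k => p k ω)
    (fun k => h.nonneg k ω) (fun k => h.le_one k ω) (fun k => h.pred_le k ω) m
  rw [le_div_iff₀ (by positivity)]
  have h2 : (1 / ((m + 1 : ℕ) : ℝ) * ∑ k ∈ Finset.range (m + 1), D k ω - ε / (α + ε)) *
      (((m + 1 : ℕ) : ℝ) * (α + ε)) =
      (α + ε) * ∑ k ∈ Finset.range (m + 1), D k ω - (m + 1) * ε := by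
    push_cast
    field_simp
  rw [h2, Nat.add_sub_cancel]
  linarith

variable [IsProbabilityMeasure μ]

theorem integrable (h : IsContractingProcess μ ℱ α ε D p) (k : ℕ) : Integrable (D k) μ :=
  IsBoundedMartingaleDiff.integrable_of_bounded ((h.measurable k).mono (ℱ.le k) le_rfl) 1
    fun ω => abs_le.2 ⟨by linarith [h.nonneg k ω], h.le_one k ω⟩

theorem integrable_pred (h : IsContractingProcess μ ℱ α ε D p) (k : ℕ) : Integrable (p k) μ :=
  IsBoundedMartingaleDiff.integrable_of_bounded ((h.measurable_pred k).mono (ℱ.le k) le_rfl) 1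
    fun ω => abs_le.2 ⟨by linarith [h.pred_nonneg k ω], h.pred_le_one k ω⟩

theorem isBoundedMartingaleDiff (h : IsContractingProcess μ ℱ α ε D p) :
    IsBoundedMartingaleDiff μ ℱ fun k ω => D (k + 1) ω - p k ω where
  measurable k := (h.measurable (k + 1)).sub
    ((h.measurable_pred k).mono (ℱ.mono (Nat.le_succ k)) le_rfl)
  abs_le_one k ω := abs_le.2
    ⟨by linarith [h.nonneg (k + 1) ω, h.pred_le_one k ω],
      by linarith [h.le_one (k + 1) ω, h.pred_nonneg k ω]⟩
  condExp_eq_zero k := by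
    have h1 := condExp_sub (h.integrable (k + 1)) (h.integrable_pred k) (ℱ k)
    have h2 := condExp_of_stronglyMeasurable (ℱ.le k) (h.measurable_pred k).stronglyMeasurable
      (h.integrable_pred k)
    filter_upwards [h1, h.condExp_eq k] with ω h1 h3
    refine h1.trans ?_
    simp [h2, h3]

/-- The Bernoulli variance bound: 1/4 + (1 - 2p)(D - p) - (D - p)² = D(1 - D) + (p - 1/2)² ≥ 0, and
the linear term has mean 0. -/
theorem integral_sq_le (h : IsContractingProcess μ ℱ α ε D p) (k : ℕ) :
    ∫ ω, (D (k + 1) ω - p k ω) ^ 2 ∂μ ≤ 1 / 4 := by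
  have hd := h.isBoundedMartingaleDiff
  have hZ : Measurable[ℱ k] fun ω => 1 - 2 * p k ω := ((h.measurable_pred k).const_mul 2).const_sub 1
  have hC : ∀ ω, |1 - 2 * p k ω| ≤ 1 := fun ω =>
    abs_le.2 ⟨by linarith [h.pred_le_one k ω], by linarith [h.pred_nonneg k ω]⟩
  have h0 := hd.integral_mul_eq_zero k hZ 1 hC
  have hi := hd.integrable_mul k hZ 1 hC
  calc ∫ ω, (D (k + 1) ω - p k ω) ^ 2 ∂μ
      ≤ ∫ ω, ((1 - 2 * p k ω) * (D (k + 1) ω - p k ω) + 1 / 4) ∂μ := by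
        refine integral_mono ?_ (hi.add (integrable_const _)) fun ω => ?_
        · refine IsBoundedMartingaleDiff.integrable_of_bounded
            ((hd.measurable_ambient k).pow_const 2) (1 ^ 2) fun ω => ?_
          rw [abs_pow]
          gcongr
          exact hd.abs_le_one k ω
        · have h1 := h.nonneg (k + 1) ω
          have h2 := h.le_one (k + 1) ω
          simp only
          nlinarith [sq_nonneg (p k ω - 1 / 2), mul_nonneg h1 (sub_nonneg.2 h2)]
    _ = 1 / 4 := by
        rw [integral_add hi (integrable_const _), h0]
        simp

theorem integral_succ_le (h : IsContractingProcess μ ℱ α ε D p) (k : ℕ) :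
    ∫ ω, D (k + 1) ω ∂μ ≤ ε + (1 - α - ε) * ∫ ω, D k ω ∂μ := by
  calc ∫ ω, D (k + 1) ω ∂μ = ∫ ω, (μ[D (k + 1) | ℱ k]) ω ∂μ := (integral_condExp (ℱ.le k)).symm
    _ = ∫ ω, p k ω ∂μ := integral_congr_ae (h.condExp_eq k)
    _ ≤ ∫ ω, (ε + (1 - α - ε) * D k ω) ∂μ :=
        integral_mono (h.integrable_pred k)
          ((integrable_const _).add ((h.integrable k).const_mul _)) (h.pred_le k)
    _ = _ := by
        rw [integral_add (integrable_const _) ((h.integrable k).const_mul _), integral_const_mul]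
        simp

theorem sum_integral_le (h : IsContractingProcess μ ℱ α ε D p) (hα1 : α < 1)
    (hε0 : 0 < ε) (hεα : ε < α) {n : ℕ} (hn : 1 ≤ n) :
    1 / (n : ℝ) * ∑ k ∈ Finset.range n, ∫ ω, D k ω ∂μ ≤
      ε / (α + ε) + (1 - (1 - α - ε) ^ n) / (n * (α + ε)) *
        (∫ ω, D 0 ω ∂μ - ε / (α + ε)) := by
  have ha : 0 < α + ε := by linarith
  have hn' : (0 : ℝ) < n := by exact_mod_cast hn
  have h1 := sum_le_of_le_affine hα1 hε0 hεα (q := fun k => ∫ ω, D k ω ∂μ) h.integral_succ_le n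
  calc _ ≤ 1 / (n : ℝ) * (n * (ε / (α + ε)) + (1 - (1 - α - ε) ^ n) / (α + ε) *
        (∫ ω, D 0 ω ∂μ - ε / (α + ε))) := mul_le_mul_of_nonneg_left h1 (by positivity)
    _ = _ := by field_simp

theorem measureReal_average_ge_le (h : IsContractingProcess μ ℱ α ε D p) (hα0 : 0 < α)
    (hα1 : α < 1) (hε0 : 0 < ε) {n : ℕ} (hn : 1 ≤ n) {x : ℝ} (hx : 0 < x) :
    μ.real {ω | ε / (α + ε) + D 0 ω / (n * (α + ε)) + x / Real.sqrt n ≤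
        1 / (n : ℝ) * ∑ k ∈ Finset.range n, D k ω} ≤
      Real.exp (-((α + ε) ^ 2 / 2) * x ^ 2) := by
  have ha : 0 < α + ε := by linarith
  have hn' : (0 : ℝ) < n := by exact_mod_cast hn
  have hs : 0 < Real.sqrt n := Real.sqrt_pos.2 hn'
  have hss : Real.sqrt n ^ 2 = n := Real.sq_sqrt hn'.le
  have hy : 0 ≤ (α + ε) * x * Real.sqrt n := by positivity
  refine (measureReal_mono ?_).trans
    ((h.isBoundedMartingaleDiff.measureReal_exists_le_sum hn hy).trans (le_of_eq ?_))
  · intro ω hω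
    refine ⟨n - 1, Nat.sub_le _ _, ?_⟩
    have h1 := h.average_sub_le hα0 hα1 hε0 hn ω
    have h2 : D 0 ω / (n * (α + ε)) + x / Real.sqrt n ≤
        (∑ k ∈ Finset.range (n - 1), (D (k + 1) ω - p k ω) + D 0 ω) / (n * (α + ε)) := by
      rw [Set.mem_ofPred_eq] at hω
      linarith
    rw [add_div, add_comm, add_le_add_iff_right, le_div_iff₀ (by positivity)] at h2
    refine le_trans (le_of_eq ?_) h2
    calc (α + ε) * x * Real.sqrt n = x / Real.sqrt n * (Real.sqrt n ^ 2 * (α + ε)) := by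
          field_simp
      _ = _ := by rw [hss]
  · congr 1
    rw [mul_pow, hss]
    field_simp

theorem integral_average_sub_sq_le (h : IsContractingProcess μ ℱ α ε D p) (hα1 : α < 1)
    (hε0 : 0 < ε) (hεα : ε < α) {n : ℕ} (hn : 1 ≤ n) :
    ∫ ω, (max (1 / (n : ℝ) * ∑ k ∈ Finset.range n, D k ω - ε / (α + ε)) 0) ^ 2 ∂μ ≤
      2 / (n : ℝ) ^ 2 * (1 / (α + ε) ^ 2) + 2 / (n : ℝ) * (α ^ 2 / (α + ε) ^ 4) := by
  have hα0 : 0 < α := by linarith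
  have ha : 0 < α + ε := by linarith
  have hn' : (0 : ℝ) < n := by exact_mod_cast hn
  have hd := h.isBoundedMartingaleDiff
  set M : Ω → ℝ := fun ω => ∑ k ∈ Finset.range (n - 1), (D (k + 1) ω - p k ω) with hM
  have hMint : Integrable (fun ω => M ω ^ 2) μ :=
    IsBoundedMartingaleDiff.integrable_of_bounded
      (((hd.measurable_sum (n - 1)).mono (ℱ.le _) le_rfl).pow_const 2) (((n - 1 : ℕ) : ℝ) ^ 2)
      fun ω => by rw [abs_pow]; gcongr; exact hd.abs_sum_le (n - 1) ω
  have hM2 : ∫ ω, M ω ^ 2 ∂μ ≤ n / 4 := by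
    refine (hd.integral_sum_sq_le h.integral_sq_le (n - 1)).trans ?_
    have : ((n - 1 : ℕ) : ℝ) ≤ n := by exact_mod_cast Nat.sub_le _ _
    linarith
  have hpt : ∀ ω, (max (1 / (n : ℝ) * ∑ k ∈ Finset.range n, D k ω - ε / (α + ε)) 0) ^ 2 ≤
      2 / (n * (α + ε)) ^ 2 * M ω ^ 2 + 2 / (n * (α + ε)) ^ 2 := by
    intro ω
    have h1 := h.average_sub_le hα0 hα1 hε0 hn ω
    have hD0 := h.nonneg 0 ω
    have hD1 := h.le_one 0 ω
    have h2 : ((M ω + D 0 ω) / (n * (α + ε))) ^ 2 ≤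
        2 / (n * (α + ε)) ^ 2 * M ω ^ 2 + 2 / (n * (α + ε)) ^ 2 := by
      have h3 : (M ω + D 0 ω) ^ 2 ≤ 2 * M ω ^ 2 + 2 := by
        nlinarith [sq_nonneg (M ω - D 0 ω)]
      calc ((M ω + D 0 ω) / (n * (α + ε))) ^ 2 = (M ω + D 0 ω) ^ 2 / (n * (α + ε)) ^ 2 := div_pow _ _ _
        _ ≤ (2 * M ω ^ 2 + 2) / (n * (α + ε)) ^ 2 := by gcongr
        _ = _ := by ring
    rcases le_total (1 / (n : ℝ) * ∑ k ∈ Finset.range n, D k ω - ε / (α + ε)) 0 with h0 | h0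
    · rw [max_eq_right h0]
      refine le_trans ?_ h2
      rw [zero_pow two_ne_zero]
      exact sq_nonneg _
    · rw [max_eq_left h0]
      exact (pow_le_pow_left₀ h0 h1 2).trans h2
  -- Here ε < α enters, as α + ε ≤ 2α: it turns the variance bound 1/4 into the factor α²/(α+ε)².
  have hfrac : (1 : ℝ) / 4 ≤ α ^ 2 / (α + ε) ^ 2 := by
    rw [div_le_div_iff₀ (by norm_num) (by positivity)]
    nlinarith
  calc _ ≤ ∫ ω, (2 / (n * (α + ε)) ^ 2 * M ω ^ 2 + 2 / (n * (α + ε)) ^ 2) ∂μ :=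
        integral_mono_of_nonneg (Filter.Eventually.of_forall fun ω => sq_nonneg _)
          ((hMint.const_mul _).add (integrable_const _)) (Filter.Eventually.of_forall hpt)
    _ = 2 / (n * (α + ε)) ^ 2 * ∫ ω, M ω ^ 2 ∂μ + 2 / (n * (α + ε)) ^ 2 := by
        rw [integral_add (hMint.const_mul _) (integrable_const _), integral_const_mul]
        simp
    _ ≤ 2 / (n * (α + ε)) ^ 2 * (n / 4) + 2 / (n * (α + ε)) ^ 2 := by gcongr
    _ = 2 / (n : ℝ) ^ 2 * (1 / (α + ε) ^ 2) + 2 / (n : ℝ) * (1 / (α + ε) ^ 2) * (1 / 4) := by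
        field_simp
        ring
    _ ≤ 2 / (n : ℝ) ^ 2 * (1 / (α + ε) ^ 2) +
        2 / (n : ℝ) * (1 / (α + ε) ^ 2) * (α ^ 2 / (α + ε) ^ 2) := by gcongr
    _ = _ := by
        field_simp

theorem exists_ae_average_le (h : IsContractingProcess μ ℱ α ε D p) (hα0 : 0 < α) (hα1 : α < 1)
    (hε0 : 0 < ε) :
    ∃ K : Ω → ℝ, Measurable K ∧ ∀ᵐ ω ∂μ, ∀ n : ℕ, 1 ≤ n →
      1 / (n : ℝ) * ∑ k ∈ Finset.range n, D k ω ≤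
        ε / (α + ε) + K ω / n + 2 * Real.sqrt (Real.log n / n) := by
  have ha : 0 < α + ε := by linarith
  set g : ℕ → Ω → ℝ := fun n ω => n * (1 / (n : ℝ) * ∑ k ∈ Finset.range n, D k ω -
    ε / (α + ε) - 2 * Real.sqrt (Real.log n / n)) with hg
  have hgm : ∀ n, Measurable (g n) := fun n =>
    ((((Finset.measurable_fun_sum _ fun k _ =>
      (h.measurable k).mono (ℱ.le k) le_rfl).const_mul _).sub_const _).sub_const _).const_mul _
  -- The pointwise constants B carry no measurability, so K is the supremum of the actual excesses;
  -- B only shows that it is almost surely a supremum of a bounded set.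
  refine ⟨fun ω => ⨆ n, g n ω, Measurable.iSup hgm, ?_⟩
  -- Division by n(α+ε) turns c = 2(α+ε) into the coefficient 2.
  filter_upwards [h.isBoundedMartingaleDiff.ae_exists_sum_le (c := 2 * (α + ε)) (by positivity)]
    with ω ⟨B, hB0, hB⟩ n hn
  have hbdd : BddAbove (Set.range fun n => g n ω) := by
    refine ⟨(B + 1) / (α + ε), ?_⟩
    rintro _ ⟨n, rfl⟩
    rcases Nat.eq_zero_or_pos n with rfl | hn
    · simp only [hg, Nat.cast_zero, zero_mul]
      positivity
    have hn' : (0 : ℝ) < n := by exact_mod_cast hn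
    have h1 := h.average_sub_le hα0 hα1 hε0 hn ω
    have hD1 := h.le_one 0 ω
    have h2 : Real.sqrt (((n - 1 : ℕ) : ℝ) * Real.log ((n - 1 : ℕ) : ℝ)) ≤
        n * Real.sqrt (Real.log n / n) := by
      have h3 : n * Real.sqrt (Real.log n / n) = Real.sqrt (n * Real.log n) := by
        rw [← Real.sqrt_sq hn'.le, ← Real.sqrt_mul (sq_nonneg _), Real.sqrt_sq hn'.le]
        congr 1
        field_simp
      rw [h3]
      have hle : ((n - 1 : ℕ) : ℝ) ≤ n := by exact_mod_cast Nat.sub_le _ _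
      rcases Nat.eq_zero_or_pos (n - 1) with h0 | h0
      · rw [h0, Nat.cast_zero, zero_mul, Real.sqrt_zero]
        exact Real.sqrt_nonneg _
      · have h0' : (0 : ℝ) < ((n - 1 : ℕ) : ℝ) := by exact_mod_cast h0
        gcongr
    have h4 := hB (n - 1)
    have h5 : (∑ k ∈ Finset.range (n - 1), (D (k + 1) ω - p k ω) + D 0 ω) ≤
        2 * (α + ε) * (n * Real.sqrt (Real.log n / n)) + (B + 1) := by
      have := mul_le_mul_of_nonneg_left h2 (by positivity : 0 ≤ 2 * (α + ε))
      linarith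
    simp only [hg]
    calc _ ≤ n * ((2 * (α + ε) * (n * Real.sqrt (Real.log n / n)) + (B + 1)) / (n * (α + ε)) -
          2 * Real.sqrt (Real.log n / n)) := by
          refine mul_le_mul_of_nonneg_left (sub_le_sub_right (h1.trans ?_) _) hn'.le
          exact div_le_div_of_nonneg_right h5 (by positivity)
      _ = (B + 1) / (α + ε) := by
          field_simp
          ring
  have hn' : (0 : ℝ) < n := by exact_mod_cast hn
  have h1 : g n ω ≤ ⨆ n, g n ω := le_ciSup hbdd n
  have h2 : 1 / (n : ℝ) * ∑ k ∈ Finset.range n, D k ω - ε / (α + ε) -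
      2 * Real.sqrt (Real.log n / n) ≤ (⨆ n, g n ω) / n := by
    rw [le_div_iff₀ hn', mul_comm]
    exact h1
  linarith

end IsContractingProcess

/-! ### Assembly of the coupling. -/

theorem mainTheorem2 {E : Type u} [TopologicalSpace E] [PolishSpace E] [MeasurableSpace E]
    [BorelSpace E] (P Pε : Kernel E E) [IsMarkovKernel P] [IsMarkovKernel Pε]
    (α ε : ℝ) (hα0 : 0 < α) (hα1 : α < 1) (hε0 : 0 < ε) (hεα : ε < α)
    (localApprox : ∀ x : E, tvDist (Pε x) (P x) ≤ ε)
    (crossDoeblin : ∀ x y : E, tvDist (Pε x) (P y) ≤ 1 - α)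
    (ν : Measure (E × E)) [IsProbabilityMeasure ν] :
    ∃ (Ω : Type u) (_ : MeasurableSpace Ω) (μ : Measure Ω) (_ : IsProbabilityMeasure μ)
      (X Xε : ℕ → Ω → E),
      IsChainCoupling μ P Pε ν X Xε ∧
      (∀ n : ℕ, 1 ≤ n →
        (1 / (n : ℝ)) * ∑ k ∈ Finset.range n, μ.real {ω | X k ω ≠ Xε k ω} ≤
          ε / (α + ε) + (1 - (1 - α - ε) ^ n) / (n * (α + ε)) *
            (μ.real {ω | X 0 ω ≠ Xε 0 ω} - ε / (α + ε))) ∧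
      (∃ K : Ω → ℝ, Measurable K ∧ ∀ᵐ ω ∂μ, ∀ n : ℕ, 1 ≤ n →
        disagreeFrac X Xε n ω ≤
          ε / (α + ε) + K ω / n + 2 * Real.sqrt (Real.log n / n)) ∧
      (∀ n : ℕ, 1 ≤ n →
        ∫ ω, (max (disagreeFrac X Xε n ω - ε / (α + ε)) 0) ^ 2 ∂μ ≤
          2 / (n : ℝ) ^ 2 * (1 / (α + ε) ^ 2) + 2 / (n : ℝ) * (α ^ 2 / (α + ε) ^ 4)) ∧
      (∀ n : ℕ, 1 ≤ n → ∀ lam : ℝ, 0 < lam →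
        μ.real {ω | ε / (α + ε) + disagree X Xε 0 ω / (n * (α + ε)) + lam / Real.sqrt n ≤
            disagreeFrac X Xε n ω} ≤
          Real.exp (-((α + ε) ^ 2 / 2) * lam ^ 2)) := by
  have hdiag : MeasurableSet {p : E × E | p.1 ≠ p.2} :=
    (measurableSet_eq_fun measurable_fst measurable_snd).compl
  obtain ⟨Q, hQM, hQ1, hQ2, hQd⟩ := exists_coupling_kernel hdiag
    (P.comap Prod.fst measurable_fst) (Pε.comap (Prod.snd : E × E → E) measurable_snd)
  obtain ⟨μ, hμ, hinit, hmarkov⟩ := exists_markovChain_measure Q ν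
  set X : ℕ → (ℕ → E × E) → E := fun k ω => (ω k).1 with hX
  set Xε : ℕ → (ℕ → E × E) → E := fun k ω => (ω k).2 with hXε
  have hpast : ∀ n, pairPast X Xε n = Filtration.piLE (X := fun _ : ℕ => E × E) n :=
    pairPast_eval_eq_piLE
  have hcoup : IsChainCoupling μ P Pε ν X Xε :=
    { measurable_left := fun n => (measurable_pi_apply n).fst
      measurable_right := fun n => (measurable_pi_apply n).snd
      map_init := hinit
      markov_left := fun n A hA => by
        rw [hpast]
        refine (hmarkov n _ (measurable_fst hA)).trans (Filter.Eventually.of_forall fun ω => ?_)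
        exact congrArg ENNReal.toReal (hQ1 (ω n) A hA)
      markov_right := fun n A hA => by
        rw [hpast]
        refine (hmarkov n _ (measurable_snd hA)).trans (Filter.Eventually.of_forall fun ω => ?_)
        exact congrArg ENNReal.toReal (hQ2 (ω n) A hA) }
  have heval : ∀ k, Measurable[Filtration.piLE (X := fun _ : ℕ => E × E) k]
      fun ω : ℕ → E × E => ω k := fun k => by
    rw [Filtration.piLE_eq_comap_frestrictLe]
    exact (measurable_pi_apply (⟨k, by simp⟩ : Finset.Iic k)).comp
      (comap_measurable (Preorder.frestrictLe (π := fun _ : ℕ => E × E) k))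
  have hproc : IsContractingProcess μ (Filtration.piLE (X := fun _ : ℕ => E × E)) α ε
      (disagree X Xε) fun k ω => (Q (ω k)).real {p | p.1 ≠ p.2} :=
    { measurable := fun k =>
        (measurable_const.indicator hdiag : Measurable
          ({p : E × E | p.1 ≠ p.2}.indicator fun _ => (1 : ℝ))).comp (heval k)
      measurable_pred := fun k =>
        (Kernel.measurable_coe Q hdiag).ennreal_toReal.comp (heval k)
      nonneg := fun k ω => Set.indicator_nonneg (fun _ _ => zero_le_one) _
      le_one := fun k ω => Set.indicator_le_self' (fun _ _ => zero_le_one) _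
      pred_nonneg := fun k ω => measureReal_nonneg
      pred_le_one := fun k ω => measureReal_le_one
      condExp_eq := fun k => hmarkov k _ hdiag
      pred_le := fun k ω => by
        have hstep : ∀ r : ℝ, 0 ≤ r → tvDist (Pε (ω k).2) (P (ω k).1) ≤ r →
            (Q (ω k)).real {p | p.1 ≠ p.2} ≤ r := fun r hr hle =>
          ENNReal.toReal_le_of_le_ofReal hr ((hQd (ω k)).trans (ENNReal.ofReal_le_ofReal hle))
        -- The affine bound interpolates the two hypotheses: it equals ε at D = 0 and 1 - α at D =
        -- 1.
        by_cases hω : (ω k).1 = (ω k).2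
        · have h0 : disagree X Xε k ω = 0 := Set.indicator_of_notMem (by simp [hX, hXε, hω]) _
          rw [h0, mul_zero, add_zero]
          exact hstep ε hε0.le (by rw [← hω]; exact localApprox _)
        · have h1 : disagree X Xε k ω = 1 := Set.indicator_of_mem (by simpa [hX, hXε] using hω) _
          rw [h1]
          refine (hstep (1 - α) (by linarith) (crossDoeblin _ _)).trans (by linarith) }
  have hprob : ∀ k, μ.real {ω | X k ω ≠ Xε k ω} = ∫ ω, disagree X Xε k ω ∂μ := fun k => by
    have hm : MeasurableSet {ω | X k ω ≠ Xε k ω} :=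
      (measurable_pi_apply k : Measurable fun ω : ℕ → E × E => ω k) hdiag
    exact (by simpa using integral_indicator_const (μ := μ) (1 : ℝ) hm :
      ∫ ω, {ω' | X k ω' ≠ Xε k ω'}.indicator (fun _ => (1 : ℝ)) ω ∂μ = _).symm
  refine ⟨ℕ → E × E, inferInstance, μ, hμ, X, Xε, hcoup, fun n hn => ?_,
    hproc.exists_ae_average_le hα0 hα1 hε0,
    fun n hn => hproc.integral_average_sub_sq_le hα1 hε0 hεα hn,
    fun n hn lam hlam => hproc.measureReal_average_ge_le hα0 hα1 hε0 hn hlam⟩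
  simp only [hprob]
  exact hproc.sum_integral_le hα1 hε0 hεα hn
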